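/- Let $\mathcal N(x)=\sum_{i=1}^m w_i\max(\ell_i(x),0)+b$ be a shallow ReLU network on $\mathbb R^n$, with affine activation functions $\ell_i(x)=(W^{|1}x+b^{|1})_i$. Assume that the activation hyperplanes are distinct: for $i\ne j$, the zero sets of $\ell_i$ and $\ell_j$ are not the same non-empty set. A full-dimensional region is a non-empty set $R_s=\{x:\operatorname{sign}\ell_i(x)=s(i),\ i=1,\dots,m\}$ with $s\in\{-1,+1\}^m$; on it $\mathcal N$ equals the affine function $\mathcal T_s=\sum_i w_i\tfrac12(s(i)+|s(i)|)\,\ell_i+b$. Let $x_0$ satisfy $\mathcal N(x_0)<0$ and lie in a full-dimensional region $R_{s_0}$, the base region; a hyperplane $i$ is called unflipped for $R_s$ if $s(i)=s_0(i)$ and flipped if $s(i)=-s_0(i)$. Consider the following algorithm. It keeps a table $T$, initially $\{s_0\}$, and a list $V$ (the current level), initially $[s_0]$. While $V$ is non-empty, it processes each $s\in V$ in turn as follows, and then replaces $V$ by the list of all the index functions newly inserted in $T$ meanwhile. 1. (Forward pass.) For every unflipped hyperplane $i$ of $R_s$, solve the linear program of maximizing $t$ over $(x,t)\in\mathbb R^n\times\mathbb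 R$ subject to $t\ge 0$, $\ell_i(x)=0$, $-s(j)\ell_j(x)+t\le 0$ for all $j\neq i$, and $\mathcal T_s(x)+t\le 0$. If its optimal value is positive (possibly $+\infty$) and $s$ with the sign of $i$ reversed is not in $T$, insert that index function in $T$. 2. (Backward pass.) If the maximum of $t$ subject to $t\ge0$, $-s(j)\ell_j(x)+t\le0$ for all $j$, and $\mathcal T_s(x)+t\le0$, is positive, do the same for every flipped hyperplane $i$ of $R_s$. Then the algorithm terminates, and the table $T$ that it returns consists of exactly the index functions of the full-dimensional regions that meet the connected component of $\{x:\mathcal N(x)<0\}$ containing $x_0$. In particular, if $\mathcal N$ has no zero in the connected component $C$ of $\operatorname{int}(\{x:\mathcal N(x)\le 0\})$ containing $x_0$, then $T$ consists of exactly the index functions of the full-dimensional regions that meet $C$. -/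

import Mathlib

namespace ReLUEnum

noncomputable section

/-- Real-valued affine functions on `ℝⁿ` (with the max-norm). -/
abbrev Aff (n : ℕ) := (Fin n → ℝ) →ᵃ[ℝ] ℝ

/-- An indexing function: a sign in `{-1, 0, +1}` for each of the `m` affine functions. -/
abbrev Index (m : ℕ) := Fin m → SignType

/-! ### Hyperplane arrangements -/

/-- `H^q_l`: the hyperplane `l = 0` for `q = 0`, the open half-spaces `l < 0` and `l > 0` for
`q = -1` and `q = +1`. -/
def halfSpace {n : ℕ} (l : Aff n) : SignType → Set (Fin n → ℝ)
  | .neg => {x | l x < 0}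
  | .zero => {x | l x = 0}
  | .pos => {x | 0 < l x}

/-- The set cut out by an indexing function `s`. -/
def region {n m : ℕ} (l : Fin m → Aff n) (s : Index m) : Set (Fin n → ℝ) :=
  ⋂ i, halfSpace (l i) (s i)

/-- `s` is the indexing function of a full-dimensional region of the arrangement. -/
def IsFullDimRegion {n m : ℕ} (l : Fin m → Aff n) (s : Index m) : Prop :=
  (region l s).Nonempty ∧ ∀ i, s i ≠ 0

/-- The affine functions `-s₀(i) · lᵢ` have the same hyperplanes as the `lᵢ`, and the region with
index `s₀` is the base region (all signs `-1`) for them. This is the index, with respect to these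
functions, of the region whose index with respect to the `lᵢ` is `s`. For `s₀ = -1` it is `s`. -/
def rebasedIndex {m : ℕ} (s₀ s : Index m) : Index m := fun i => -(s₀ i * s i)

/-- The flipped hyperplanes of a region, in increasing order. -/
def flipped {m : ℕ} (s : Index m) : List (Fin m) := (List.finRange m).filter fun i => 0 < s i

/-- The unflipped hyperplanes of a region, in increasing order. -/
def unflipped {m : ℕ} (s : Index m) : List (Fin m) := (List.finRange m).filter fun i => s i < 0

/-- Change the sign of the `i`-th hyperplane. -/
def flipAt {m : ℕ} (s : Index m) (i : Fin m) : Index m := Function.update s i (-s i)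

/-! ### Shallow ReLU networks -/

/-- The parameters of a shallow network `ℝⁿ → ℝ` with `m` hidden neurons. -/
structure ShallowNN (n m : ℕ) where
  W₁ : Matrix (Fin m) (Fin n) ℝ
  b₁ : Fin m → ℝ
  W₂ : Fin m → ℝ
  b₂ : ℝ

namespace ShallowNN

variable {n m : ℕ}

/-- `x ↦ W₂ max(W₁ x + b₁, 0) + b₂`. -/
def eval (N : ShallowNN n m) (x : Fin n → ℝ) : ℝ :=
  N.W₂ ⬝ᵥ (fun i => max ((N.W₁.mulVec x + N.b₁) i) 0) + N.b₂

/-- The activation boundaries `x ↦ (W₁ x + b₁)ᵢ`. -/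
def act (N : ShallowNN n m) (i : Fin m) : Aff n :=
  ((LinearMap.proj i).comp N.W₁.mulVecLin).toAffineMap + AffineMap.const ℝ _ (N.b₁ i)

/-- The affine function `𝒯_R` that describes the network on the region `R` with index `s`:
`x ↦ ∑ᵢ W₂ᵢ · ½(s(i) + |s(i)|) · actᵢ(x) + b₂`. -/
def localMap (N : ShallowNN n m) (s : Index m) : Aff n :=
  (∑ i, (N.W₂ i * (((s i : ℝ) + |(s i : ℝ)|) / 2)) • N.act i) + AffineMap.const ℝ _ N.b₂

end ShallowNN

/-! ### The enumeration algorithm -/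

/-- Optimal value of the linear program that maximizes the slack `x_s` over the feasible pairs
`(x, x_s)`: it is `-∞` if the program is infeasible and `+∞` if it is unbounded. -/
def lpCost {n : ℕ} (feasible : Set ((Fin n → ℝ) × ℝ)) : EReal := ⨆ p ∈ feasible, (p.2 : EReal)

/-- The constraint functions of a region: `A(x) ≤ 0` describes the closed region with index `s`. -/
def constr {n m : ℕ} (l : Fin m → Aff n) (s : Index m) (i : Fin m) : Aff n := -(s i : ℝ) • l i

/-- Feasible set of the linear program that tests the `i`-th hyperplane of the region `s`:
`A(x) + x_s · sel ≤ 0`, where `sel` is `0` at `i` and `1` elsewhere, `A(x)ᵢ ≥ 0`, `x_s ≥ 0`, and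
`g(x) + x_s ≤ 0` for every extra constraint `g`. -/
def faceLP {n m : ℕ} (l : Fin m → Aff n) (s : Index m) (i : Fin m) (addConstr : List (Aff n)) :
    Set ((Fin n → ℝ) × ℝ) :=
  {p | (∀ j, constr l s j p.1 + p.2 * (if j = i then 0 else 1) ≤ 0) ∧
    0 ≤ constr l s i p.1 ∧ 0 ≤ p.2 ∧ ∀ g ∈ addConstr, g p.1 + p.2 ≤ 0}

/-- Feasible set of the linear program that precedes a backward pass. -/
def regionLP {n m : ℕ} (l : Fin m → Aff n) (s : Index m) (g : Aff n) :
    Set ((Fin n → ℝ) × ℝ) :=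
  {p | (∀ j, constr l s j p.1 + p.2 ≤ 0) ∧ g p.1 + p.2 ≤ 0 ∧ 0 ≤ p.2}

open Classical in
/-- `FindSuccessors`. It reads and updates the global table `tab`; the result is the pair of the
list of newly found regions and the updated table. -/
def findSuccessors {n m : ℕ} (l : Fin m → Aff n) (s : Index m) (testHypers : List (Fin m))
    (addConstr : List (Aff n)) (tab : Finset (Index m)) : List (Index m) × Finset (Index m) :=
  testHypers.foldl
    (fun st i =>
      if 0 < lpCost (faceLP l s i addConstr) then
        if flipAt s i ∉ st.2 then (st.1 ++ [flipAt s i], insert (flipAt s i) st.2) else st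
      else st)
    ([], tab)

open Classical in
/-- `FindSuccessorsFwdBkwd`: a forward pass over the unflipped hyperplanes of `s`, followed, if the
region test succeeds, by a backward pass over its flipped hyperplanes. Flipped and unflipped refer
to the base region `s₀`. -/
def findSuccessorsFwdBkwd {n m : ℕ} (N : ShallowNN n m) (s₀ s : Index m)
    (tab : Finset (Index m)) : List (Index m) × Finset (Index m) :=
  let fwd := findSuccessors N.act s (unflipped (rebasedIndex s₀ s)) [N.localMap s] tab
  let bkwd :=
    if 0 < lpCost (regionLP N.act s (N.localMap s)) then
      findSuccessors N.act s (flipped (rebasedIndex s₀ s)) [N.localMap s] fwd.2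
    else ([], fwd.2)
  (fwd.1 ++ bkwd.1, bkwd.2)

/-- One execution of the body of the `while` loop: from the current level list and table to the
next level list and table. -/
def levelStep {n m : ℕ} (N : ShallowNN n m) (s₀ : Index m)
    (st : List (Index m) × Finset (Index m)) : List (Index m) × Finset (Index m) :=
  st.1.foldl
    (fun acc s =>
      (acc.1 ++ (findSuccessorsFwdBkwd N s₀ s acc.2).1, (findSuccessorsFwdBkwd N s₀ s acc.2).2))
    ([], st.2)

/-- Level list and table after `k` executions of the body of the `while` loop. -/
def levelState {n m : ℕ} (N : ShallowNN n m) (s₀ : Index m) (k : ℕ) :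
    List (Index m) × Finset (Index m) :=
  (levelStep N s₀)^[k] ([s₀], {s₀})

/-- The sub-level set region enumeration, started in the region with index `s₀`, terminates and
returns the table `T`: the `while` loop stops when the level list is empty for the first time. -/
def Returns {n m : ℕ} (N : ShallowNN n m) (s₀ : Index m) (T : Finset (Index m)) : Prop :=
  ∃ k, (levelState N s₀ k).1 = [] ∧ (∀ j < k, (levelState N s₀ j).1 ≠ []) ∧
    T = (levelState N s₀ k).2

end

end ReLUEnum

namespace ReLUEnum

open Topology Filter

variable {n m : ℕ}

/-! ### Signs and regions -/

/-! The algorithm is a breadth-first search in a graph on index functions: `s` and `flipAt s i` are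
adjacent when the network is negative somewhere on their common relatively open facet
(`FacetCrossing`). Since `N.localMap s` agrees with the network on that facet, this is what
positivity of the facet program tests (`lpCost_faceLP_pos_iff`). A failed region test loses nothing,
because a negative facet point has negative region points nearby. Hence the table returned is the
set of vertices reachable from `s₀` (`exists_returns`).

Reachable regions meet the component: the network is affine on a closed region, so the segment from
a negative facet point to a negative point of the region stays negative (`mem_component_of_facet`).

Conversely, inside a convex open set where the network is negative, a generic segment between two
regions crosses the hyperplanes one at a time, and each crossing is an edge of the graph
(`reachable_signIndex`, `reachable_of_convex`). Distinctness of the hyperplanes makes generic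
segments available. The component is covered by such convex sets, and connectedness links them
(`reachable_of_inter_isPreconnected`). -/

theorem mem_halfSpace {l : Aff n} {σ : SignType} {x : Fin n → ℝ} :
    x ∈ halfSpace l σ ↔ SignType.sign (l x) = σ := by
  cases σ
  · exact (sign_eq_zero_iff (a := l x)).symm
  · exact (sign_eq_neg_one_iff (a := l x)).symm
  · exact (sign_eq_one_iff (a := l x)).symm

theorem mem_region {l : Fin m → Aff n} {s : Index m} {x : Fin n → ℝ} :
    x ∈ region l s ↔ ∀ i, SignType.sign (l i x) = s i := by
  simp [region, mem_halfSpace]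

theorem sign_eq_iff_mul_pos {σ : SignType} (hσ : σ ≠ 0) (r : ℝ) :
    SignType.sign r = σ ↔ 0 < (σ : ℝ) * r := by
  cases σ
  · exact absurd rfl hσ
  · simpa using sign_eq_neg_one_iff
  · simpa using sign_eq_one_iff

theorem sign_eq_of_mul_pos {a b : ℝ} (h : 0 < a * b) : SignType.sign a = SignType.sign b := by
  rcases mul_pos_iff.1 h with ⟨ha, hb⟩ | ⟨ha, hb⟩
  · rw [sign_pos ha, sign_pos hb]
  · rw [sign_neg ha, sign_neg hb]

theorem sign_eq_neg_of_mul_neg {a b : ℝ} (h : a * b < 0) :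
    SignType.sign b = -SignType.sign a := by
  rcases mul_neg_iff.1 h with ⟨ha, hb⟩ | ⟨ha, hb⟩
  · rw [sign_pos ha, sign_neg hb]
  · rw [sign_neg ha, sign_pos hb, neg_neg]

theorem flipAt_same (s : Index m) (i : Fin m) : flipAt s i i = -s i := by
  simp [flipAt]

theorem flipAt_ne (s : Index m) {i j : Fin m} (h : j ≠ i) : flipAt s i j = s j := by
  simp [flipAt, h]

theorem flipAt_flipAt (s : Index m) (i : Fin m) : flipAt (flipAt s i) i = s := by
  simp [flipAt]

theorem flipAt_ne_zero {s : Index m} (hs : ∀ j, s j ≠ 0) (i j : Fin m) : flipAt s i j ≠ 0 := by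
  by_cases h : j = i
  · subst h
    rw [flipAt_same]
    have := hs j
    cases h : s j <;> simp_all
  · rw [flipAt_ne s h]
    exact hs j

/-- A vanishing activation contributes nothing whichever sign `s` assigns to it, so the agreement
extends from the region to its facets. -/
theorem ShallowNN.localMap_eq_eval (N : ShallowNN n m) {s : Index m} {x : Fin n → ℝ}
    (h : ∀ j, N.act j x = 0 ∨ SignType.sign (N.act j x) = s j) : N.localMap s x = N.eval x := by
  have hact : ∀ j, (N.W₁.mulVec x + N.b₁) j = N.act j x := fun j => rfl
  have hl : N.localMap s x
      = (∑ i, (N.W₂ i * (((s i : ℝ) + |(s i : ℝ)|) / 2)) * N.act i x) + N.b₂ := by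
    have hsum : ∀ S : Finset (Fin m),
        (∑ i ∈ S, (N.W₂ i * (((s i : ℝ) + |(s i : ℝ)|) / 2)) • N.act i) x
          = ∑ i ∈ S, (N.W₂ i * (((s i : ℝ) + |(s i : ℝ)|) / 2)) * N.act i x := by
      intro S
      induction S using Finset.induction_on with
      | empty => simp
      | insert a S ha ih => simp [Finset.sum_insert ha, ih]
    simp [localMap, hsum]
  rw [hl, eval, dotProduct]
  congr 1
  refine Finset.sum_congr rfl fun j _ => ?_
  rw [hact]
  rcases h j with h0 | h0
  · simp [h0]
  · rw [← h0]
    rcases lt_trichotomy (N.act j x) 0 with h | h | h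
    · simp [sign_neg h, h.le]
    · simp [h]
    · simp [sign_pos h, h.le]

theorem aff_continuous (l : Aff n) : Continuous l := l.continuous_of_finiteDimensional

theorem ShallowNN.continuous_eval (N : ShallowNN n m) : Continuous N.eval := by
  have : N.eval = fun x => (∑ i, N.W₂ i * max (N.act i x) 0) + N.b₂ := rfl
  rw [this]
  refine .add (continuous_finsetSum _ fun i _ => ?_) continuous_const
  exact continuous_const.mul ((aff_continuous _).max continuous_const)

theorem aff_lineMap (l : Aff n) (p q : Fin n → ℝ) (t : ℝ) :
    l (AffineMap.lineMap p q t) = (1 - t) * l p + t * l q := by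
  rw [AffineMap.apply_lineMap, AffineMap.lineMap_apply_ring]

theorem isOpen_region (l : Fin m → Aff n) {s : Index m} (hs : ∀ i, s i ≠ 0) :
    IsOpen (region l s) := by
  have : region l s = ⋂ i, {x | 0 < (s i : ℝ) * l i x} := by
    ext x
    simp [mem_region, sign_eq_iff_mul_pos (hs _)]
  rw [this]
  exact isOpen_iInter_of_finite fun i =>
    isOpen_lt continuous_const (continuous_const.mul (aff_continuous _))

/-! ### The linear programs -/

/-- The network is negative at some point of the relatively open facet of the region `s` on the
`i`-th hyperplane. -/
def FacetCrossing (N : ShallowNN n m) (s : Index m) (i : Fin m) : Prop :=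
  ∃ x, N.act i x = 0 ∧ (∀ j ≠ i, SignType.sign (N.act j x) = s j) ∧ N.eval x < 0

theorem FacetCrossing.flipAt {N : ShallowNN n m} {s : Index m} {i : Fin m}
    (h : FacetCrossing N s i) : FacetCrossing N (flipAt s i) i := by
  obtain ⟨x, h0, hj, hx⟩ := h
  exact ⟨x, h0, fun j hji => by rw [flipAt_ne s hji, hj j hji], hx⟩

theorem lpCost_pos_iff {F : Set ((Fin n → ℝ) × ℝ)} : 0 < lpCost F ↔ ∃ p ∈ F, 0 < p.2 := by
  simp only [lpCost, lt_iSup_iff, EReal.coe_pos, exists_prop]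

theorem constr_apply (l : Fin m → Aff n) (s : Index m) (i : Fin m) (x : Fin n → ℝ) :
    constr l s i x = -((s i : ℝ) * l i x) := by
  simp [constr]

/-- The two constraints at `i` force `N.act i x = 0`, and a positive slack makes all the others
strict. Conversely, finitely many strict inequalities leave room for a small positive slack. -/
theorem lpCost_faceLP_pos_iff (N : ShallowNN n m) {s : Index m} (hs : ∀ i, s i ≠ 0) (i : Fin m) :
    0 < lpCost (faceLP N.act s i [N.localMap s]) ↔ FacetCrossing N s i := by
  have hsr : (s i : ℝ) ≠ 0 := by
    have := hs i
    cases h : s i <;> simp_all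
  rw [lpCost_pos_iff]
  constructor
  · rintro ⟨⟨x, t⟩, ⟨h1, h2, -, h3⟩, ht⟩
    simp only [constr_apply, List.mem_singleton, forall_eq] at h1 h2 h3 ht
    have h0 : N.act i x = 0 := by
      have := h1 i
      simp only [if_true, mul_zero, add_zero] at this
      have : (s i : ℝ) * N.act i x = 0 := by linarith
      exact (mul_eq_zero.1 this).resolve_left hsr
    have hj : ∀ j ≠ i, SignType.sign (N.act j x) = s j := by
      intro j hji
      rw [sign_eq_iff_mul_pos (hs j)]
      have := h1 j
      rw [if_neg hji] at this
      linarith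
    refine ⟨x, h0, hj, ?_⟩
    rw [← N.localMap_eq_eval (s := s)]
    · linarith
    · intro j
      by_cases hji : j = i
      · exact .inl (hji ▸ h0)
      · exact .inr (hj j hji)
  · rintro ⟨x, h0, hj, hx⟩
    rw [← N.localMap_eq_eval (s := s)] at hx
    swap
    · intro j
      by_cases hji : j = i
      · exact .inl (hji ▸ h0)
      · exact .inr (hj j hji)
    have hev : ∀ᶠ t : ℝ in 𝓝[>] 0, 0 < t ∧ (∀ j, j ≠ i → t ≤ (s j : ℝ) * N.act j x) ∧
        t ≤ -N.localMap s x := by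
      refine (eventually_mem_nhdsWithin).and (.and (eventually_all.2 fun j => ?_) ?_)
      · by_cases hji : j = i
        · exact .of_forall fun t h => absurd hji h
        · have := (sign_eq_iff_mul_pos (hs j) _).1 (hj j hji)
          exact ((eventually_le_nhds this).filter_mono nhdsWithin_le_nhds).mono fun t ht _ => ht
      · exact (eventually_le_nhds (by linarith)).filter_mono nhdsWithin_le_nhds
    obtain ⟨t, ht, h1, h2⟩ := hev.exists
    refine ⟨(x, t), ⟨fun j => ?_, ?_, ht.le, ?_⟩, ht⟩
    · by_cases hji : j = i
      · subst hji
        simp [constr_apply, h0]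
      · simp only [constr_apply, if_neg hji]
        linarith [h1 j hji]
    · simp [constr_apply, h0]
    · simp only [List.mem_singleton, forall_eq]
      linarith

theorem lpCost_regionLP_pos (N : ShallowNN n m) {s : Index m} (hs : ∀ i, s i ≠ 0)
    {x : Fin n → ℝ} (hxs : x ∈ region N.act s) (hx : N.eval x < 0) :
    0 < lpCost (regionLP N.act s (N.localMap s)) := by
  rw [mem_region] at hxs
  rw [← N.localMap_eq_eval fun j => .inr (hxs j)] at hx
  have hev : ∀ᶠ t : ℝ in 𝓝[>] 0, 0 < t ∧ (∀ j, t ≤ (s j : ℝ) * N.act j x) ∧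
      t ≤ -N.localMap s x := by
    refine (eventually_mem_nhdsWithin).and (.and (eventually_all.2 fun j => ?_) ?_)
    · have := (sign_eq_iff_mul_pos (hs j) _).1 (hxs j)
      exact (eventually_le_nhds this).filter_mono nhdsWithin_le_nhds
    · exact (eventually_le_nhds (by linarith)).filter_mono nhdsWithin_le_nhds
  obtain ⟨t, ht, h1, h2⟩ := hev.exists
  refine lpCost_pos_iff.2 ⟨(x, t), ⟨fun j => ?_, ?_, ht.le⟩, ht⟩
  · rw [constr_apply]
    linarith [h1 j]
  · dsimp only
    linarith

/-! ### Facets and the regions next to them -/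

/-- Arbitrarily close to a facet point there are points of the region. -/
theorem FacetCrossing.exists_mem_region {N : ShallowNN n m} {s : Index m} (hs : ∀ i, s i ≠ 0)
    {i : Fin m} (hi : ∃ z, N.act i z ≠ 0) {x : Fin n → ℝ} (h0 : N.act i x = 0)
    (hj : ∀ j ≠ i, SignType.sign (N.act j x) = s j) (hx : N.eval x < 0) :
    ∃ y ∈ region N.act s, N.eval y < 0 := by
  obtain ⟨w, hw⟩ : ∃ w, 0 < (s i : ℝ) * N.act i w := by
    obtain ⟨z, hz⟩ := hi
    have hsr : (s i : ℝ) ≠ 0 := by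
      have := hs i
      cases h : s i <;> simp_all
    rcases lt_or_gt_of_ne (mul_ne_zero hsr hz) with h | h
    -- Reflection in `x`, a zero of `N.act i`, moves `z` to the other side of the hyperplane.
    · refine ⟨AffineMap.lineMap x z (-1 : ℝ), ?_⟩
      rw [aff_lineMap, h0]
      linarith
    · exact ⟨z, h⟩
  have hc : Tendsto (fun t : ℝ => AffineMap.lineMap x w t) (𝓝[>] (0 : ℝ)) (𝓝 x) := by
    have : Continuous (fun t : ℝ => (AffineMap.lineMap x w t : Fin n → ℝ)) :=
      AffineMap.lineMap_continuous
    have := this.tendsto 0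
    rw [AffineMap.lineMap_apply_zero] at this
    exact this.mono_left nhdsWithin_le_nhds
  -- A short move from `x` towards `w` enters the correct side of hyperplane `i` and keeps all the
  -- open conditions.
  have hev : ∀ᶠ t : ℝ in 𝓝[>] 0, 0 < t ∧
      (∀ j, j ≠ i → 0 < (s j : ℝ) * N.act j (AffineMap.lineMap x w t)) ∧
      N.eval (AffineMap.lineMap x w t) < 0 := by
    refine (eventually_mem_nhdsWithin).and (.and (eventually_all.2 fun j => ?_) ?_)
    · by_cases hji : j = i
      · exact .of_forall fun t h => absurd hji h
      · have := (sign_eq_iff_mul_pos (hs j) _).1 (hj j hji)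
        have h2 : ∀ᶠ y in 𝓝 x, 0 < (s j : ℝ) * N.act j y :=
          (continuous_const.mul (aff_continuous _)).continuousAt.eventually (lt_mem_nhds this)
        exact (hc.eventually h2).mono fun t ht _ => ht
    · exact hc.eventually (N.continuous_eval.continuousAt.eventually (gt_mem_nhds hx))
  obtain ⟨t, ht, h1, h2⟩ := hev.exists
  refine ⟨_, mem_region.2 fun j => ?_, h2⟩
  rw [sign_eq_iff_mul_pos (hs j)]
  by_cases hji : j = i
  · subst hji
    rw [aff_lineMap, h0]
    have := mul_pos ht hw
    linarith
  · exact h1 j hji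

/-! ### The breadth-first search -/

/-- The second component of `r` is the table `tab` enlarged by `A`; the first one lists what is
new in it. -/
def ExtendsBy (A : Set (Index m)) (tab : Finset (Index m))
    (r : List (Index m) × Finset (Index m)) : Prop :=
  (∀ x, x ∈ r.2 ↔ x ∈ tab ∨ x ∈ A) ∧ ∀ x, x ∈ r.1 ↔ x ∈ r.2 ∧ x ∉ tab

theorem ExtendsBy.append {A B : Set (Index m)} {tab : Finset (Index m)}
    {r q : List (Index m) × Finset (Index m)} (h : ExtendsBy A tab r) (h' : ExtendsBy B r.2 q) :
    ExtendsBy (A ∪ B) tab (r.1 ++ q.1, q.2) := by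
  constructor
  · intro x
    simp only [h'.1, h.1, Set.mem_union]
    tauto
  · intro x
    simp only [List.mem_append, h.2, h'.2, h'.1, h.1]
    tauto

theorem findSuccessors_extendsBy (l : Fin m → Aff n) (s : Index m) (L : List (Fin m))
    (G : List (Aff n)) (tab : Finset (Index m)) :
    ExtendsBy {x | ∃ i ∈ L, 0 < lpCost (faceLP l s i G) ∧ x = flipAt s i} tab
      (findSuccessors l s L G tab) := by
  induction L using List.reverseRecOn with
  | nil => simp [findSuccessors, ExtendsBy]
  | append_singleton L i ih =>
    -- The last iteration depends on the past only through the table, so it can be restarted with an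
    -- empty list of finds.
    have hrec : findSuccessors l s (L ++ [i]) G tab =
        ((findSuccessors l s L G tab).1 ++ (findSuccessors l s [i] G
          (findSuccessors l s L G tab).2).1, (findSuccessors l s [i] G
          (findSuccessors l s L G tab).2).2) := by
      simp only [findSuccessors, List.foldl_append, List.foldl_cons, List.foldl_nil]
      split_ifs <;> simp
    have hone : ∀ tab : Finset (Index m),
        ExtendsBy {x | 0 < lpCost (faceLP l s i G) ∧ x = flipAt s i} tab
          (findSuccessors l s [i] G tab) := by
      intro tab
      simp only [findSuccessors, List.foldl_cons, List.foldl_nil]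
      by_cases h1 : 0 < lpCost (faceLP l s i G)
      · by_cases h2 : flipAt s i ∈ tab
        · simp only [h2, not_true_eq_false, if_false, ExtendsBy, Set.mem_ofPred_eq, h1, true_and]
          refine ⟨fun x => ⟨.inl, ?_⟩, fun x => by tauto⟩
          rintro (h | rfl)
          exacts [h, h2]
        · simp only [h2, not_false_eq_true, if_true, ExtendsBy, Finset.mem_insert,
            Set.mem_ofPred_eq, h1, true_and, List.nil_append, List.mem_singleton]
          refine ⟨fun x => or_comm, fun x => ⟨?_, ?_⟩⟩
          · rintro rfl
            exact ⟨.inl rfl, h2⟩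
          · tauto
      · simp [ExtendsBy, h1]
    rw [hrec]
    convert ih.append (hone _) using 1
    ext x
    simp only [List.mem_append, List.mem_singleton, Set.mem_ofPred_eq, Set.mem_union]
    constructor
    · rintro ⟨k, hk | rfl, h⟩
      exacts [.inl ⟨k, hk, h⟩, .inr h]
    · rintro (⟨k, hk, h⟩ | h)
      exacts [⟨k, .inl hk, h⟩, ⟨i, .inr rfl, h⟩]

theorem mem_unflipped_or_flipped {s₀ s : Index m} (hs₀ : ∀ i, s₀ i ≠ 0) (hs : ∀ i, s i ≠ 0)
    (i : Fin m) :
    i ∈ unflipped (rebasedIndex s₀ s) ∨ i ∈ flipped (rebasedIndex s₀ s) := by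
  have h1 := hs₀ i
  have h2 := hs i
  simp only [unflipped, flipped, rebasedIndex, List.mem_filter, List.mem_finRange, true_and]
  have key : ∀ a b : SignType, a ≠ 0 → b ≠ 0 → -(a * b) < 0 ∨ 0 < -(a * b) := by decide
  exact (key _ _ h1 h2).imp decide_eq_true decide_eq_true

/-- The neighbours of `s` across facets on which the network is somewhere negative. -/
def neighbors (N : ShallowNN n m) (s : Index m) : Set (Index m) :=
  {x | ∃ i, FacetCrossing N s i ∧ x = flipAt s i}

/-- The forward and backward passes together test every hyperplane. If the region test fails, the
network is nowhere negative on the region, hence on none of its open facets, and there are no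
neighbours to miss. -/
theorem findSuccessorsFwdBkwd_extendsBy (N : ShallowNN n m)
    (hne : ∀ i, ∃ z, N.act i z ≠ 0) {s₀ s : Index m}
    (hs₀ : ∀ i, s₀ i ≠ 0) (hs : ∀ i, s i ≠ 0) (tab : Finset (Index m)) :
    ExtendsBy (neighbors N s) tab (findSuccessorsFwdBkwd N s₀ s tab) := by
  have hf := findSuccessors_extendsBy N.act s (unflipped (rebasedIndex s₀ s)) [N.localMap s] tab
  have hcover := mem_unflipped_or_flipped hs₀ hs
  simp only [lpCost_faceLP_pos_iff N hs] at hf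
  by_cases hreg : 0 < lpCost (regionLP N.act s (N.localMap s))
  · have hb := findSuccessors_extendsBy N.act s (flipped (rebasedIndex s₀ s)) [N.localMap s]
      (findSuccessors N.act s (unflipped (rebasedIndex s₀ s)) [N.localMap s] tab).2
    simp only [lpCost_faceLP_pos_iff N hs] at hb
    simp only [findSuccessorsFwdBkwd, if_pos hreg]
    convert hf.append hb using 1
    ext x
    simp only [neighbors, Set.mem_ofPred_eq, Set.mem_union]
    constructor
    · rintro ⟨i, h⟩
      rcases hcover i with hi | hi
      exacts [.inl ⟨i, hi, h⟩, .inr ⟨i, hi, h⟩]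
    · rintro (⟨i, -, h⟩ | ⟨i, -, h⟩) <;> exact ⟨i, h⟩
  · have hno : ∀ i, ¬ FacetCrossing N s i := by
      rintro i ⟨x, h0, hj, hx⟩
      obtain ⟨y, hy, hy'⟩ := FacetCrossing.exists_mem_region hs (hne i) h0 hj hx
      exact hreg (lpCost_regionLP_pos N hs hy hy')
    simp only [findSuccessorsFwdBkwd, if_neg hreg, List.append_nil]
    simpa [neighbors, hno] using hf

theorem levelStep_extendsBy (N : ShallowNN n m) (hne : ∀ i, ∃ z, N.act i z ≠ 0)
    {s₀ : Index m} (hs₀ : ∀ i, s₀ i ≠ 0) (V : List (Index m)) (hV : ∀ s ∈ V, ∀ i, s i ≠ 0)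
    (tab : Finset (Index m)) :
    ExtendsBy {x | ∃ s ∈ V, x ∈ neighbors N s} tab (levelStep N s₀ (V, tab)) := by
  induction V using List.reverseRecOn with
  | nil => simp [levelStep, ExtendsBy]
  | append_singleton V s ih =>
    have ih := ih fun s hs => hV s (List.mem_append_left _ hs)
    have h2 := findSuccessorsFwdBkwd_extendsBy N hne hs₀ (hV s (by simp))
      (levelStep N s₀ (V, tab)).2
    have h3 := ih.append h2
    have hrec : levelStep N s₀ (V ++ [s], tab) =
        ((levelStep N s₀ (V, tab)).1 ++
          (findSuccessorsFwdBkwd N s₀ s (levelStep N s₀ (V, tab)).2).1,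
          (findSuccessorsFwdBkwd N s₀ s (levelStep N s₀ (V, tab)).2).2) := by
      simp only [levelStep, List.foldl_append, List.foldl_cons, List.foldl_nil]
    rw [hrec]
    convert h3 using 1
    ext x
    simp only [List.mem_append, List.mem_singleton, Set.mem_ofPred_eq, Set.mem_union]
    constructor
    · rintro ⟨k, hk | rfl, h⟩
      exacts [.inl ⟨k, hk, h⟩, .inr h]
    · rintro (⟨k, hk, h⟩ | h)
      exacts [⟨k, .inl hk, h⟩, ⟨s, .inr rfl, h⟩]

/-- `s` is reached from `s₀` by crossing facets at points where the network is negative. -/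
def Reachable (N : ShallowNN n m) : Index m → Index m → Prop :=
  Relation.ReflTransGen fun s s' => s' ∈ neighbors N s

theorem Reachable.refl (N : ShallowNN n m) (s : Index m) : Reachable N s s :=
  Relation.ReflTransGen.refl

theorem Reachable.ne_zero {N : ShallowNN n m} {s₀ s : Index m} (h : Reachable N s₀ s)
    (hs₀ : ∀ i, s₀ i ≠ 0) : ∀ i, s i ≠ 0 := by
  induction h with
  | refl => exact hs₀
  | tail _ hst ih =>
    obtain ⟨i, -, rfl⟩ := hst
    exact flipAt_ne_zero ih i

theorem Reachable.symm {N : ShallowNN n m} {s t : Index m} (h : Reachable N s t) :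
    Reachable N t s := by
  induction h with
  | refl => exact Relation.ReflTransGen.refl
  | @tail u _ _ hut ih =>
    obtain ⟨i, hi, rfl⟩ := hut
    exact Relation.ReflTransGen.head ⟨i, hi.flipAt, (flipAt_flipAt u i).symm⟩ ih

theorem levelState_succ (N : ShallowNN n m) (s₀ : Index m) (k : ℕ) :
    levelState N s₀ (k + 1) = levelStep N s₀ (levelState N s₀ k) :=
  Function.iterate_succ_apply' _ _ _

/-- The last clause says that entries outside the current level have been fully processed. Once the
level is empty, the table is closed under `neighbors`. -/
theorem levelState_invariant (N : ShallowNN n m) (hne : ∀ i, ∃ z, N.act i z ≠ 0)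
    {s₀ : Index m} (hs₀ : ∀ i, s₀ i ≠ 0) (k : ℕ) :
    s₀ ∈ (levelState N s₀ k).2 ∧ (∀ s ∈ (levelState N s₀ k).1, s ∈ (levelState N s₀ k).2) ∧
      (∀ s ∈ (levelState N s₀ k).2, Reachable N s₀ s) ∧
      ∀ s ∈ (levelState N s₀ k).2, s ∉ (levelState N s₀ k).1 →
        ∀ t ∈ neighbors N s, t ∈ (levelState N s₀ k).2 := by
  induction k with
  | zero =>
    simpa [levelState] using Reachable.refl N s₀
  | succ k ih =>
    rw [levelState_succ]
    obtain ⟨h0, h1, h2, h3⟩ := ih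
    obtain ⟨e1, e2⟩ := levelStep_extendsBy N hne hs₀ (levelState N s₀ k).1
      (fun s hs => (h2 s (h1 s hs)).ne_zero hs₀) (levelState N s₀ k).2
    refine ⟨(e1 _).2 (.inl h0), fun s hs => ((e2 s).1 hs).1, fun s hs => ?_, fun s hs hn t ht => ?_⟩
    · rcases (e1 s).1 hs with h | ⟨r, hr, h⟩
      · exact h2 s h
      · exact Relation.ReflTransGen.tail (h2 r (h1 r hr)) h
    -- An entry absent from the new level is not new, so it was already in the old table.
    · have hs' : s ∈ (levelState N s₀ k).2 := by
        by_contra h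
        exact hn ((e2 s).2 ⟨hs, h⟩)
      by_cases hv : s ∈ (levelState N s₀ k).1
      · exact (e1 t).2 (.inr ⟨s, hv, ht⟩)
      · exact (e1 t).2 (.inl (h3 s hs' hv t ht))

/-- A non-empty new level means that the table has grown strictly, which can happen only finitely
often among finitely many index functions. -/
theorem exists_levelState_eq_nil (N : ShallowNN n m) (hne : ∀ i, ∃ z, N.act i z ≠ 0)
    {s₀ : Index m} (hs₀ : ∀ i, s₀ i ≠ 0) : ∃ k, (levelState N s₀ k).1 = [] := by
  by_contra! hcon
  have hcard : ∀ k, k ≤ (levelState N s₀ k).2.card := by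
    intro k
    induction k with
    | zero => exact Nat.zero_le _
    | succ k ih =>
      obtain ⟨-, h1, h2, -⟩ := levelState_invariant N hne hs₀ k
      obtain ⟨e1, e2⟩ := levelStep_extendsBy N hne hs₀ (levelState N s₀ k).1
        (fun s hs => (h2 s (h1 s hs)).ne_zero hs₀) (levelState N s₀ k).2
      obtain ⟨s, hs⟩ := List.exists_mem_of_ne_nil _ (hcon (k + 1))
      rw [levelState_succ] at hs ⊢
      have hlt : (levelState N s₀ k).2 ⊂ (levelStep N s₀ (levelState N s₀ k)).2 :=
        (Finset.ssubset_iff_of_subset fun x hx => (e1 x).2 (.inl hx)).2 ⟨s, (e2 s).1 hs⟩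
      exact Nat.succ_le_of_lt (ih.trans_lt (Finset.card_lt_card hlt))
  have := (hcard (Fintype.card (Index m) + 1)).trans (Finset.card_le_univ _)
  omega

/-- The enumeration terminates and returns the set of reachable index functions. -/
theorem exists_returns (N : ShallowNN n m) (hne : ∀ i, ∃ z, N.act i z ≠ 0)
    {s₀ : Index m} (hs₀ : ∀ i, s₀ i ≠ 0) :
    ∃ T, Returns N s₀ T ∧ ∀ s, s ∈ T ↔ Reachable N s₀ s := by
  classical
  have hex := exists_levelState_eq_nil N hne hs₀
  refine ⟨_, ⟨Nat.find hex, Nat.find_spec hex, fun j hj => Nat.find_min hex hj, rfl⟩, fun s => ?_⟩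
  obtain ⟨h0, -, h2, h3⟩ := levelState_invariant N hne hs₀ (Nat.find hex)
  refine ⟨h2 s, fun h => ?_⟩
  induction h with
  | refl => exact h0
  | tail _ hst ih => exact h3 _ ih (by simp [Nat.find_spec hex]) _ hst

/-! ### Generic points -/

theorem dense_ne_zero {l : Aff n} (h : ∃ z, l z ≠ 0) : Dense {x | l x ≠ 0} := by
  obtain ⟨z, hz⟩ := h
  intro x
  by_cases hx : l x = 0
  · have hc : Tendsto (fun t : ℝ => AffineMap.lineMap x z t) (𝓝[>] (0 : ℝ)) (𝓝 x) := by
      have : Continuous (fun t : ℝ => (AffineMap.lineMap x z t : Fin n → ℝ)) :=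
        AffineMap.lineMap_continuous
      have := this.tendsto 0
      rw [AffineMap.lineMap_apply_zero] at this
      exact this.mono_left nhdsWithin_le_nhds
    refine mem_closure_of_tendsto hc ?_
    filter_upwards [eventually_mem_nhdsWithin] with t ht
    have ht : 0 < t := ht
    change l _ ≠ 0
    rw [aff_lineMap, hx, mul_zero, zero_add]
    exact mul_ne_zero ht.ne' hz
  · exact subset_closure hx

theorem exists_forall_ne_zero {ι : Type*} [Finite ι] (f : ι → Aff n) (hf : ∀ k, ∃ z, f k z ≠ 0)
    {U : Set (Fin n → ℝ)} (hU : IsOpen U) (hne : U.Nonempty) : ∃ x ∈ U, ∀ k, f k x ≠ 0 := by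
  have hd : Dense (⋂ k, {x | f k x ≠ 0}) :=
    dense_iInter_of_isOpen (fun k => isOpen_ne_fun (aff_continuous _) continuous_const)
      fun k => dense_ne_zero (hf k)
  obtain ⟨x, hxU, hx⟩ := hd.inter_open_nonempty U hU hne
  exact ⟨x, hxU, fun k => Set.mem_iInter.1 hx k⟩

/-! ### Walking along generic segments -/

/-- The signs of all the activation functions at a point. -/
noncomputable def signIndex (N : ShallowNN n m) (x : Fin n → ℝ) : Index m := fun i => SignType.sign (N.act i x)

/-- Induction on the number of hyperplanes separating `p` from `q`. The segment meets a separating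
hyperplane `j` at parameter `N.act j p / (N.act j p - N.act j q)`, and `hgen` says that these
parameters are distinct. So the first crossing is at a relatively interior facet point, and `p` can
be moved just past it. -/
theorem reachable_signIndex (N : ShallowNN n m) (B : Set (Fin n → ℝ)) (hB : Convex ℝ B)
    (hneg : ∀ x ∈ B, N.eval x < 0) (q : Fin n → ℝ) (hq : q ∈ B) (hq0 : ∀ i, N.act i q ≠ 0)
    (k : ℕ) (p : Fin n → ℝ) (hp : p ∈ B) (hp0 : ∀ i, N.act i p ≠ 0)
    (hk : (Finset.univ.filter fun i => N.act i p * N.act i q < 0).card = k)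
    (hgen : ∀ i j, i ≠ j → N.act i p * N.act i q < 0 → N.act j p * N.act j q < 0 →
      N.act i p * N.act j q - N.act j p * N.act i q ≠ 0) :
    Reachable N (signIndex N p) (signIndex N q) := by
  induction k generalizing p with
  | zero =>
    have : signIndex N p = signIndex N q := by
      funext i
      have hi : ¬ N.act i p * N.act i q < 0 := by
        have := Finset.card_eq_zero.1 hk
        rw [Finset.filter_eq_empty_iff] at this
        exact this (Finset.mem_univ i)
      have hpos : 0 < N.act i p * N.act i q :=
        lt_of_le_of_ne (not_lt.1 hi) (mul_ne_zero (hp0 i) (hq0 i)).symm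
      exact sign_eq_of_mul_pos hpos
    rw [this]
    exact Relation.ReflTransGen.refl
  | succ k ih =>
    have hFne : (Finset.univ.filter fun i => N.act i p * N.act i q < 0).Nonempty :=
      Finset.card_pos.1 (by omega)
    obtain ⟨i, hi, hmin⟩ := Finset.exists_min_image _
      (fun i => N.act i p / (N.act i p - N.act i q)) hFne
    simp only [Finset.mem_filter, Finset.mem_univ, true_and] at hi hmin
    have hden : ∀ j, N.act j p * N.act j q < 0 → N.act j p - N.act j q ≠ 0 := by
      intro j hj h
      rw [sub_eq_zero.1 h] at hj
      exact absurd hj (not_lt.2 (mul_self_nonneg _))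
    have hτeq : ∀ j, N.act j p * N.act j q < 0 → ∀ t, N.act j (AffineMap.lineMap p q t)
        = (N.act j p - N.act j q) * (N.act j p / (N.act j p - N.act j q) - t) := by
      intro j hj t
      rw [aff_lineMap, mul_sub, mul_div_cancel₀ _ (hden j hj)]
      ring
    have hsq : ∀ j, N.act j p * N.act j q < 0 → 0 < N.act j p * (N.act j p - N.act j q) := by
      intro j hj
      nlinarith [mul_self_nonneg (N.act j p)]
    have hlt : ∀ j, j ≠ i → N.act j p * N.act j q < 0 →
        N.act i p / (N.act i p - N.act i q) < N.act j p / (N.act j p - N.act j q) := by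
      intro j hji hj
      refine lt_of_le_of_ne (hmin j hj) fun h => hgen i j hji.symm hi hj ?_
      rw [div_eq_div_iff (hden i hi) (hden j hj)] at h
      linarith
    have hτ0 : 0 < N.act i p / (N.act i p - N.act i q) := by
      -- Multiplying numerator and denominator by `N.act i p` makes both positive, whatever the sign
      -- of `N.act i p`.
      rw [← mul_div_mul_left _ _ (hp0 i)]
      exact div_pos (mul_self_pos.2 (hp0 i)) (hsq i hi)
    have hτ1 : N.act i p / (N.act i p - N.act i q) < 1 := by
      rw [← mul_div_mul_left _ _ (hp0 i), div_lt_one (hsq i hi)]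
      linarith
    set τ := N.act i p / (N.act i p - N.act i q) with hτ
    have hxi : N.act i (AffineMap.lineMap p q τ) = 0 := by
      rw [hτeq i hi, ← hτ, sub_self, mul_zero]
    have hxj : ∀ j, j ≠ i → 0 < N.act j p * N.act j (AffineMap.lineMap p q τ) := by
      intro j hji
      rcases lt_or_gt_of_ne (mul_ne_zero (hp0 j) (hq0 j)) with hj | hj
      · rw [hτeq j hj, ← mul_assoc]
        exact mul_pos (hsq j hj) (sub_pos.2 (hlt j hji hj))
      · rw [aff_lineMap]
        have h1 := mul_pos (sub_pos.2 hτ1) (mul_self_pos.2 (hp0 j))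
        have h2 := mul_pos hτ0 hj
        linarith
    -- The new starting point lies just after the crossing of `i`, before any other hyperplane is
    -- met.
    have hev : ∀ᶠ t : ℝ in 𝓝[>] τ, τ < t ∧ t < 1 ∧
        ∀ j, j ≠ i → 0 < N.act j p * N.act j (AffineMap.lineMap p q t) := by
      refine (eventually_mem_nhdsWithin).and (.and
        ((eventually_lt_nhds hτ1).filter_mono nhdsWithin_le_nhds) (eventually_all.2 fun j => ?_))
      by_cases hji : j = i
      · exact .of_forall fun t h => absurd hji h
      · have hc : Continuous fun t : ℝ =>
            N.act j p * N.act j (AffineMap.lineMap p q t) :=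
          continuous_const.mul ((aff_continuous _).comp AffineMap.lineMap_continuous)
        exact ((hc.continuousAt.eventually (lt_mem_nhds (hxj j hji))).filter_mono
          nhdsWithin_le_nhds).mono fun t ht _ => ht
    obtain ⟨t, ht, ht1, htj⟩ := hev.exists
    have hti : N.act i p * N.act i (AffineMap.lineMap p q t) < 0 := by
      rw [hτeq i hi, ← hτ, ← mul_assoc]
      exact mul_neg_of_pos_of_neg (hsq i hi) (sub_neg.2 ht)
    have hflip : signIndex N (AffineMap.lineMap p q t) = flipAt (signIndex N p) i := by
      funext j
      by_cases hji : j = i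
      · subst hji
        rw [flipAt_same]
        exact sign_eq_neg_of_mul_neg hti
      · rw [flipAt_ne _ hji]
        exact (sign_eq_of_mul_pos (htj j hji)).symm
    have hstep : signIndex N (AffineMap.lineMap p q t) ∈ neighbors N (signIndex N p) := by
      refine ⟨i, ⟨AffineMap.lineMap p q τ, hxi, fun j hji => ?_, hneg _ ?_⟩, hflip⟩
      · exact (sign_eq_of_mul_pos (hxj j hji)).symm
      · exact hB.lineMap_mem hp hq ⟨hτ0.le, hτ1.le⟩
    have hsep : ∀ j, N.act j (AffineMap.lineMap p q t) * N.act j q < 0 ↔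
        j ≠ i ∧ N.act j p * N.act j q < 0 := by
      intro j
      by_cases hji : j = i
      · subst hji
        simp only [ne_eq, not_true_eq_false, false_and, iff_false, not_lt]
        have := mul_pos_of_neg_of_neg hti hi
        by_contra! h
        nlinarith [mul_self_pos.2 (hp0 j)]
      · simp only [ne_eq, hji, not_false_eq_true, true_and]
        rw [← sign_eq_neg_one_iff, ← sign_eq_neg_one_iff, sign_mul, sign_mul,
          sign_eq_of_mul_pos (htj j hji)]
    refine Relation.ReflTransGen.head hstep (ih _ (hB.lineMap_mem hp hq ⟨by linarith, ht1.le⟩)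
      (fun j h => ?_) ?_ fun j j' hjj hj hj' => ?_)
    · by_cases hji : j = i
      · subst hji
        rw [h, mul_zero] at hti
        exact lt_irrefl _ hti
      · have := htj j hji
        rw [h, mul_zero] at this
        exact lt_irrefl _ this
    · have : (Finset.univ.filter fun j => N.act j (AffineMap.lineMap p q t) * N.act j q < 0)
          = (Finset.univ.filter fun i => N.act i p * N.act i q < 0).erase i := by
        ext j
        simp only [Finset.mem_filter, Finset.mem_univ, true_and, Finset.mem_erase, hsep]
      rw [this, Finset.card_erase_of_mem (by simpa using hi), hk, Nat.add_sub_cancel]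
    -- Replacing `p` by the point at parameter `t` multiplies the determinant in `hgen` by `1 - t`.
    · have := mul_ne_zero (sub_pos.2 ht1).ne' (hgen j j' hjj ((hsep j).1 hj).2 ((hsep j').1 hj').2)
      rw [aff_lineMap, aff_lineMap]
      intro h
      exact this (by linarith)

theorem signIndex_eq_of_mem_region {N : ShallowNN n m} {s : Index m} {x : Fin n → ℝ}
    (h : x ∈ region N.act s) : signIndex N x = s :=
  funext (mem_region.1 h)

theorem act_ne_zero_of_mem_region {N : ShallowNN n m} {s : Index m} (hs : ∀ i, s i ≠ 0)
    {x : Fin n → ℝ} (h : x ∈ region N.act s) (i : Fin m) : N.act i x ≠ 0 := by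
  rw [← sign_ne_zero, mem_region.1 h i]
  exact hs i

/-- The activation hyperplanes are distinct. -/
def DistinctHyperplanes (N : ShallowNN n m) : Prop :=
  ∀ i j : Fin m, i ≠ j → (halfSpace (N.act i) 0).Nonempty →
    halfSpace (N.act i) 0 ≠ halfSpace (N.act j) 0

/-- It suffices to fix `p` and perturb `q`: simultaneous crossing of `i` and `j` is an affine
condition on `q`. Were it identically satisfied, `N.act i` and `N.act j` would be proportional with
non-zero factors, as neither vanishes at `p`, and their zero sets would coincide. -/
theorem reachable_of_convex {N : ShallowNN n m} (hdist : DistinctHyperplanes N)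
    {B : Set (Fin n → ℝ)} (hB : Convex ℝ B) (hBo : IsOpen B) (hneg : ∀ x ∈ B, N.eval x < 0)
    {s s' : Index m} (hs : ∀ i, s i ≠ 0) (hs' : ∀ i, s' i ≠ 0)
    (h : (region N.act s ∩ B).Nonempty) (h' : (region N.act s' ∩ B).Nonempty) :
    Reachable N s s' := by
  obtain ⟨p, hps, hpB⟩ := h
  have hp0 := act_ne_zero_of_mem_region hs hps
  -- Distinctness is assumed only for non-empty zero sets. This suffices, since the segment from `p`
  -- to `q` meets every hyperplane that separates them.
  let ι := {k : Fin m × Fin m // k.1 ≠ k.2 ∧ (halfSpace (N.act k.1) 0).Nonempty}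
  obtain ⟨q, ⟨hqs, hqB⟩, hq⟩ := exists_forall_ne_zero
    (fun k : ι => N.act k.1.1 p • N.act k.1.2 - N.act k.1.2 p • N.act k.1.1)
    (by
      rintro ⟨⟨i, j⟩, hij, hne⟩
      by_contra! hcon
      refine hdist i j hij hne (Set.ext fun z => ?_)
      have hz : N.act i p * N.act j z - N.act j p * N.act i z = 0 := by simpa using hcon z
      change N.act i z = 0 ↔ N.act j z = 0
      constructor
      · intro h0
        rw [h0, mul_zero, sub_zero] at hz
        exact (mul_eq_zero.1 hz).resolve_left (hp0 i)
      · intro h0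
        rw [h0, mul_zero, zero_sub, neg_eq_zero] at hz
        exact (mul_eq_zero.1 hz).resolve_left (hp0 j))
    ((isOpen_region N.act hs').inter hBo) h'
  rw [← signIndex_eq_of_mem_region hps, ← signIndex_eq_of_mem_region hqs]
  refine reachable_signIndex N B hB hneg q hqB (act_ne_zero_of_mem_region hs' hqs) _ p hpB hp0 rfl
    fun i j hij hi _ => ?_
  have hne : (halfSpace (N.act i) 0).Nonempty := by
    have hd : N.act i p - N.act i q ≠ 0 := by
      intro h
      rw [sub_eq_zero.1 h] at hi
      exact absurd hi (not_lt.2 (mul_self_nonneg _))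
    refine ⟨AffineMap.lineMap p q (N.act i p / (N.act i p - N.act i q)), ?_⟩
    change N.act i _ = 0
    rw [aff_lineMap]
    field_simp
    ring
  simpa using hq ⟨(i, j), hij, hne⟩

/-! ### The component of the sub-level set -/

theorem exists_region_inter_nonempty {N : ShallowNN n m} (hne : ∀ i, ∃ z, N.act i z ≠ 0)
    {U : Set (Fin n → ℝ)} (hU : IsOpen U) (h : U.Nonempty) :
    ∃ s : Index m, (∀ i, s i ≠ 0) ∧ (region N.act s ∩ U).Nonempty := by
  obtain ⟨x, hxU, hx⟩ := exists_forall_ne_zero N.act hne hU h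
  exact ⟨signIndex N x, fun i => sign_ne_zero.2 (hx i), x, mem_region.2 fun _ => rfl, hxU⟩

/-- The convex open sets on which the network is negative are called good or bad according to
whether they meet a reachable or an unreachable region. If both kinds met `C`, preconnectedness
would make a good set overlap a bad one, and a region meeting the overlap would join the two
regions. -/
theorem reachable_of_inter_isPreconnected {N : ShallowNN n m} (hdist : DistinctHyperplanes N)
    (hne : ∀ i, ∃ z, N.act i z ≠ 0) {C : Set (Fin n → ℝ)} (hC : IsPreconnected C)
    (hneg : ∀ x ∈ C, N.eval x < 0) {s s' : Index m} (hs : ∀ i, s i ≠ 0) (hs' : ∀ i, s' i ≠ 0)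
    (h : (region N.act s ∩ C).Nonempty) (h' : (region N.act s' ∩ C).Nonempty) :
    Reachable N s s' := by
  have hopen : IsOpen {x | N.eval x < 0} := isOpen_lt N.continuous_eval continuous_const
  let W : Set (Set (Fin n → ℝ)) := {B | IsOpen B ∧ Convex ℝ B ∧ ∀ x ∈ B, N.eval x < 0}
  have hball : ∀ x, N.eval x < 0 → ∃ B ∈ W, x ∈ B := by
    intro x hx
    obtain ⟨ε, hε, hsub⟩ := Metric.isOpen_iff.1 hopen x hx
    exact ⟨Metric.ball x ε, ⟨Metric.isOpen_ball, convex_ball x ε, hsub⟩, Metric.mem_ball_self hε⟩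
  let good : Set (Set (Fin n → ℝ)) :=
    {B | B ∈ W ∧ ∃ r, (∀ i, r i ≠ 0) ∧ Reachable N s r ∧ (region N.act r ∩ B).Nonempty}
  let bad : Set (Set (Fin n → ℝ)) :=
    {B | B ∈ W ∧ ∃ r, (∀ i, r i ≠ 0) ∧ ¬ Reachable N s r ∧ (region N.act r ∩ B).Nonempty}
  by_contra hcon
  obtain ⟨p, hp, hpC⟩ := h
  obtain ⟨q, hq, hqC⟩ := h'
  obtain ⟨Bp, hBp, hpB⟩ := hball p (hneg p hpC)
  obtain ⟨Bq, hBq, hqB⟩ := hball q (hneg q hqC)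
  obtain ⟨x, -, ⟨B, ⟨hB, r, hr, hrs, hrB⟩, hxB⟩, ⟨B', ⟨hB', r', hr', hrs', hrB'⟩, hxB'⟩⟩ :=
    hC (⋃₀ good) (⋃₀ bad) (isOpen_sUnion fun B hB => hB.1.1) (isOpen_sUnion fun B hB => hB.1.1)
      (by
        intro x hx
        obtain ⟨B, hB, hxB⟩ := hball x (hneg x hx)
        obtain ⟨r, hr, hrB⟩ := exists_region_inter_nonempty hne hB.1 ⟨x, hxB⟩
        by_cases hreach : Reachable N s r
        · exact .inl ⟨B, ⟨hB, r, hr, hreach, hrB⟩, hxB⟩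
        · exact .inr ⟨B, ⟨hB, r, hr, hreach, hrB⟩, hxB⟩)
      ⟨p, hpC, Bp, ⟨hBp, s, hs, Relation.ReflTransGen.refl, p, hp, hpB⟩, hpB⟩
      ⟨q, hqC, Bq, ⟨hBq, s', hs', hcon, q, hq, hqB⟩, hqB⟩
  obtain ⟨u, hu, y, hyu, hyB, hyB'⟩ :=
    exists_region_inter_nonempty hne (hB.1.inter hB'.1) ⟨x, hxB, hxB'⟩
  have h1 : Reachable N r u :=
    reachable_of_convex hdist hB.2.1 hB.1 hB.2.2 hr hu hrB ⟨y, hyu, hyB⟩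
  have h2 : Reachable N u r' :=
    reachable_of_convex hdist hB'.2.1 hB'.1 hB'.2.2 hu hr' ⟨y, hyu, hyB'⟩ hrB'
  exact hrs' ((hrs.trans h1).trans h2)

/-- A point of a region and a point of one of its facets, both with negative network values, lie in
the same component of the sub-level set. -/
theorem mem_component_of_facet {N : ShallowNN n m} {s : Index m} (hs : ∀ i, s i ≠ 0) {i : Fin m}
    {x y x₀ : Fin n → ℝ} (h0 : N.act i x = 0) (hj : ∀ j ≠ i, SignType.sign (N.act j x) = s j)
    (hx : N.eval x < 0) (hys : y ∈ region N.act s) (hy : N.eval y < 0) :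
    x ∈ connectedComponentIn {z | N.eval z < 0} x₀ ↔
      y ∈ connectedComponentIn {z | N.eval z < 0} x₀ := by
  have hseg : segment ℝ x y ⊆ {z | N.eval z < 0} := by
    rw [segment_eq_image_lineMap]
    rintro _ ⟨t, ⟨ht0, ht1⟩, rfl⟩
    -- Apart from its endpoint `x`, the segment lies in the open region, so the network is affine
    -- along it.
    have hloc : N.localMap s (AffineMap.lineMap x y t) = N.eval (AffineMap.lineMap x y t) := by
      refine N.localMap_eq_eval fun j => ?_
      rw [sign_eq_iff_mul_pos (hs j), aff_lineMap]
      have hyj := (sign_eq_iff_mul_pos (hs j) _).1 (mem_region.1 hys j)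
      by_cases hji : j = i
      · subst hji
        rw [h0, mul_zero, zero_add]
        rcases ht0.eq_or_lt with h | h
        · exact .inl (by rw [← h, zero_mul])
        · exact .inr (by linarith [mul_pos h hyj])
      · right
        have hxj := (sign_eq_iff_mul_pos (hs j) _).1 (hj j hji)
        rcases ht0.eq_or_lt with h | h
        · simpa [← h] using hxj
        · linarith [mul_pos h hyj, mul_nonneg (sub_nonneg.2 ht1) hxj.le]
    have hlx : N.localMap s x = N.eval x := N.localMap_eq_eval fun j => by
      by_cases hji : j = i
      · exact .inl (hji ▸ h0)
      · exact .inr (hj j hji)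
    have hly : N.localMap s y = N.eval y := N.localMap_eq_eval fun j => .inr (mem_region.1 hys j)
    change N.eval _ < 0
    rw [← hloc, aff_lineMap, hlx, hly]
    rcases ht0.eq_or_lt with h | h
    · simpa [← h] using hx
    · linarith [mul_neg_of_pos_of_neg h hy, mul_nonneg (sub_nonneg.2 ht1) (neg_nonneg.2 hx.le)]
  have hconn := (convex_segment x y).isPreconnected
  constructor
  · intro h
    rw [connectedComponentIn_eq h]
    exact hconn.subset_connectedComponentIn (left_mem_segment ℝ x y) hseg
      (right_mem_segment ℝ x y)
  · intro h
    rw [connectedComponentIn_eq h]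
    exact hconn.subset_connectedComponentIn (right_mem_segment ℝ x y) hseg
      (left_mem_segment ℝ x y)

/-- Membership in the component passes from a point of `u` to the facet point, and from there to a
nearby point on the other side. -/
theorem Reachable.region_inter_component {N : ShallowNN n m} (hne : ∀ i, ∃ z, N.act i z ≠ 0)
    {s₀ s : Index m} (hs₀ : ∀ i, s₀ i ≠ 0) {x₀ : Fin n → ℝ} (hx₀ : N.eval x₀ < 0)
    (hbase : x₀ ∈ region N.act s₀) (h : Reachable N s₀ s) :
    (region N.act s ∩ connectedComponentIn {x | N.eval x < 0} x₀).Nonempty := by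
  induction h with
  | refl => exact ⟨x₀, hbase, mem_connectedComponentIn hx₀⟩
  | @tail u _ hu hut ih =>
    obtain ⟨i, ⟨x, h0, hj, hx⟩, rfl⟩ := hut
    have hu0 := Reachable.ne_zero hu hs₀
    obtain ⟨y, hy, hyC⟩ := ih
    have hxC := (mem_component_of_facet hu0 h0 hj hx hy
      (connectedComponentIn_subset {z | N.eval z < 0} x₀ hyC)).2 hyC
    have hj' : ∀ j ≠ i, SignType.sign (N.act j x) = flipAt u i j := fun j hji => by
      rw [flipAt_ne u hji, hj j hji]
    obtain ⟨z, hz, hzn⟩ :=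
      FacetCrossing.exists_mem_region (flipAt_ne_zero hu0 i) (hne i) h0 hj' hx
    exact ⟨z, hz, (mem_component_of_facet (flipAt_ne_zero hu0 i) h0 hj' hx hz hzn).1 hxC⟩

/-- Without zeros, the component of the interior is a connected subset of the strict sub-level set
containing `x₀`; the other inclusion is monotonicity. -/
theorem component_interior_eq {N : ShallowNN n m} {x₀ : Fin n → ℝ} (hx₀ : N.eval x₀ < 0)
    (hzero : ∀ x ∈ connectedComponentIn (interior {x | N.eval x ≤ 0}) x₀, N.eval x ≠ 0) :
    connectedComponentIn (interior {x | N.eval x ≤ 0}) x₀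
      = connectedComponentIn {x | N.eval x < 0} x₀ := by
  have hopen : IsOpen {x | N.eval x < 0} := isOpen_lt N.continuous_eval continuous_const
  have hsub : {x | N.eval x < 0} ⊆ interior {x | N.eval x ≤ 0} :=
    interior_maximal (fun x (hx : N.eval x < 0) => hx.le) hopen
  refine Set.Subset.antisymm ?_ (connectedComponentIn_mono _ hsub)
  refine isPreconnected_connectedComponentIn.subset_connectedComponentIn
    (mem_connectedComponentIn (hsub hx₀)) fun x hx => ?_
  exact lt_of_le_of_ne (interior_subset (s := {z | N.eval z ≤ 0})
    (connectedComponentIn_subset _ _ hx)) (hzero x hx)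

end ReLUEnum

theorem theorem2 {n m : ℕ} (N : ReLUEnum.ShallowNN n m)
    (hdistinct : ∀ i j : Fin m, i ≠ j → (ReLUEnum.halfSpace (N.act i) 0).Nonempty →
      ReLUEnum.halfSpace (N.act i) 0 ≠ ReLUEnum.halfSpace (N.act j) 0)
    (x₀ : Fin n → ℝ) (hx₀ : N.eval x₀ < 0)
    (s₀ : ReLUEnum.Index m) (hs₀ : ∀ i, s₀ i ≠ 0) (hbase : x₀ ∈ ReLUEnum.region N.act s₀) :
    ∃ T : Finset (ReLUEnum.Index m), ReLUEnum.Returns N s₀ T ∧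
      (∀ s : ReLUEnum.Index m, s ∈ T ↔
        ReLUEnum.IsFullDimRegion N.act s ∧
          (ReLUEnum.region N.act s ∩ connectedComponentIn {x | N.eval x < 0} x₀).Nonempty) ∧
      ((∀ x ∈ connectedComponentIn (interior {x | N.eval x ≤ 0}) x₀, N.eval x ≠ 0) →
        ∀ s : ReLUEnum.Index m, s ∈ T ↔
          ReLUEnum.IsFullDimRegion N.act s ∧
            (ReLUEnum.region N.act s ∩
              connectedComponentIn (interior {x | N.eval x ≤ 0}) x₀).Nonempty) := by
  -- The base point lies in a full-dimensional region, so no activation function vanishes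
  -- identically.
  have hne : ∀ i, ∃ z, N.act i z ≠ 0 :=
    fun i => ⟨x₀, ReLUEnum.act_ne_zero_of_mem_region hs₀ hbase i⟩
  obtain ⟨T, hT, hmem⟩ := ReLUEnum.exists_returns N hne hs₀
  have hmain : ∀ s : ReLUEnum.Index m, s ∈ T ↔ ReLUEnum.IsFullDimRegion N.act s ∧
      (ReLUEnum.region N.act s ∩ connectedComponentIn {x | N.eval x < 0} x₀).Nonempty := by
    intro s
    rw [hmem]
    constructor
    · intro h
      have hC := h.region_inter_component hne hs₀ hx₀ hbase
      exact ⟨⟨hC.mono Set.inter_subset_left, h.ne_zero hs₀⟩, hC⟩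
    · rintro ⟨⟨-, hs⟩, hC⟩
      exact ReLUEnum.reachable_of_inter_isPreconnected hdistinct hne
        isPreconnected_connectedComponentIn
        (fun x hx => connectedComponentIn_subset {z | N.eval z < 0} x₀ hx) hs₀ hs ⟨x₀, hbase, mem_connectedComponentIn hx₀⟩ hC
  refine ⟨T, hT, hmain, fun hzero => ?_⟩
  rw [ReLUEnum.component_interior_eq hx₀ hzero]
  exact hmain
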